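/- Let $R$ be an associative ring with identity. A left $R$-module $M$ is Gorenstein flat if there is an exact sequence of flat left $R$-modules $\mathbf F=\cdots\to F_1\to F_0\to F^0\to F^1\to\cdots$ with $M\cong\operatorname{Im}(F_0\to F^0)$ such that $I\otimes_R\mathbf F$ is exact for every injective right $R$-module $I$. $R$ is left GF-closed if the class of Gorenstein flat left $R$-modules is closed under extensions. $\operatorname{Gfd}_R(M)$ denotes the least $n\ge 0$ for which there is an exact sequence $0\to G_n\to\cdots\to G_0\to M\to 0$ with all $G_i$ Gorenstein flat ($\infty$ if there is none); $\operatorname{fd}_R$ and $\operatorname{id}_R$ denote flat and injective dimension; and $\mathrm{l.Gwdim}(R)=\sup\{\operatorname{Gfd}_R(M)\mid M\text{ a left }R\text{-module}\}$. **Lemma.** Let $R$ be a left GF-closed ring with $\mathrm{l.Gwdim}(R)<\infty$. Then for every integer $n\ge 0$ the following are equivalent: 1. $\mathrm{l.Gwdim}(R)\le n$; 2. $\operatorname{Gfd}_R(M)\le n$ for every finitely presented left $R$-module $M$; 3. $\operatorname{Gfd}_R(R/I)\le n$ for every finitely generated left ideal $I$ of $R$; 4. $\operatorname{fd}_R(E)\le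 n$ for every injective right $R$-module $E$; 5. $\operatorname{fd}_R(E')\le n$ for every right $R$-module $E'$ with finite injective dimension. Consequently, $$\begin{aligned}\mathrm{l.Gwdim}(R)&=\sup\{\operatorname{Gfd}_R(R/I)\mid I\text{ a finitely generated left ideal of }R\}\\&=\sup\{\operatorname{Gfd}_R(M)\mid M\text{ a finitely presented left }R\text{-module}\}\\&=\sup\{\operatorname{fd}_R(E)\mid E\text{ an injective right }R\text{-module}\}\\&=\sup\{\operatorname{fd}_R(E')\mid E'\text{ a right }R\text{-module with }\operatorname{id}_R(E')<\infty\}.\end{aligned}$$ -/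

import Mathlib

open scoped TensorProduct ENat
open MulOpposite CategoryTheory

universe u

namespace WeakGorenstein

/-! Conventions: `R` is an associative ring with identity, not assumed commutative.  A left
`R`-module is a `Module R`, a right `R`-module is a `Module Rᵐᵒᵖ`, where `op r • a` is `a · r`. -/

section Tensor

variable (R : Type u) [Ring R]

/-- The subgroup of `A ⊗[ℤ] B` generated by the elements `(a · r) ⊗ b - a ⊗ (r · b)`, for a right
`R`-module `A` and a left `R`-module `B`. -/
def balancing (A B : Type u) [AddCommGroup A] [Module Rᵐᵒᵖ A] [AddCommGroup B] [Module R B] :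
    AddSubgroup (A ⊗[ℤ] B) :=
  AddSubgroup.closure
    {x | ∃ (a : A) (r : R) (b : B), x = (op r • a) ⊗ₜ[ℤ] b - a ⊗ₜ[ℤ] (r • b)}

/-- The abelian group `A ⊗_R B`, for a right `R`-module `A` and a left `R`-module `B`. -/
abbrev BalTensor (A B : Type u) [AddCommGroup A] [Module Rᵐᵒᵖ A] [AddCommGroup B] [Module R B] :
    Type u :=
  (A ⊗[ℤ] B) ⧸ balancing R A B

variable {A A' B B' : Type u}
  [AddCommGroup A] [Module Rᵐᵒᵖ A] [AddCommGroup A'] [Module Rᵐᵒᵖ A']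
  [AddCommGroup B] [Module R B] [AddCommGroup B'] [Module R B']

/-- The map `f ⊗ g` on tensor products over `ℤ`. -/
noncomputable def intMap (f : A →ₗ[Rᵐᵒᵖ] A') (g : B →ₗ[R] B') : A ⊗[ℤ] B →+ A' ⊗[ℤ] B' :=
  (TensorProduct.map f.toAddMonoidHom.toIntLinearMap
    g.toAddMonoidHom.toIntLinearMap).toAddMonoidHom

theorem balancing_le_comap (f : A →ₗ[Rᵐᵒᵖ] A') (g : B →ₗ[R] B') :
    balancing R A B ≤ (balancing R A' B').comap (intMap R f g) := by
  refine (AddSubgroup.closure_le _).2 ?_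
  rintro _ ⟨a, r, b, rfl⟩
  refine AddSubgroup.subset_closure ⟨f a, r, g b, ?_⟩
  simp [intMap]

/-- The group homomorphism `f ⊗_R g : A ⊗_R B → A' ⊗_R B'`. -/
noncomputable def BalTensor.map (f : A →ₗ[Rᵐᵒᵖ] A') (g : B →ₗ[R] B') :
    BalTensor R A B →+ BalTensor R A' B' :=
  QuotientAddGroup.map _ _ (intMap R f g) (balancing_le_comap R f g)

end Tensor

section Flat

variable (R : Type u) [Ring R]

/-- A left `R`-module `M` is flat: `- ⊗_R M` preserves injectivity of maps of right modules. -/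
def IsFlatLeft (M : Type u) [AddCommGroup M] [Module R M] : Prop :=
  ∀ (A B : ModuleCat.{u} Rᵐᵒᵖ) (f : A →ₗ[Rᵐᵒᵖ] B), Function.Injective f →
    Function.Injective (BalTensor.map R f (LinearMap.id : M →ₗ[R] M))

/-- A right `R`-module `E` is flat: `E ⊗_R -` preserves injectivity of maps of left modules. -/
def IsFlatRight (E : Type u) [AddCommGroup E] [Module Rᵐᵒᵖ E] : Prop :=
  ∀ (A B : ModuleCat.{u} R) (f : A →ₗ[R] B), Function.Injective f →
    Function.Injective (BalTensor.map R (LinearMap.id : E →ₗ[Rᵐᵒᵖ] E) f)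

/-- A left `R`-module `M` is Gorenstein flat: there is an exact sequence
`⋯ → F (-1) → F 0 → F 1 → F 2 → ⋯` of flat left `R`-modules such that `M` is isomorphic to the
image of `F 0 → F 1`, and which stays exact after `I ⊗_R -` for every injective right
`R`-module `I`. -/
def IsGorensteinFlat (M : Type u) [AddCommGroup M] [Module R M] : Prop :=
  ∃ (F : ℤ → ModuleCat.{u} R) (d : ∀ i : ℤ, F i →ₗ[R] F (i + 1)),
    (∀ i, IsFlatLeft R (F i)) ∧
    (∀ i, Function.Exact (d i) (d (i + 1))) ∧
    Nonempty (M ≃ₗ[R] LinearMap.range (d 0)) ∧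
    ∀ I : ModuleCat.{u} Rᵐᵒᵖ, Module.Injective Rᵐᵒᵖ I → ∀ i,
      Function.Exact (BalTensor.map R (LinearMap.id : I →ₗ[Rᵐᵒᵖ] I) (d i))
        (BalTensor.map R (LinearMap.id : I →ₗ[Rᵐᵒᵖ] I) (d (i + 1)))

/-- The class of Gorenstein flat left `R`-modules is closed under extensions. -/
def IsLeftGFClosed : Prop :=
  ∀ (A B C : ModuleCat.{u} R) (f : A →ₗ[R] B) (g : B →ₗ[R] C),
    Function.Injective f → Function.Surjective g → Function.Exact f g →
    IsGorensteinFlat R A → IsGorensteinFlat R C → IsGorensteinFlat R B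

end Flat

section Dimension

/-- There is an exact sequence `0 → G n → ⋯ → G 1 → G 0 → M → 0` of `S`-modules in which
`G 0, …, G n` belong to the class `P`.  The sequence is indexed by `ℕ` and vanishes
beyond `n`. -/
def HasResolutionLE (S : Type u) [Ring S] (P : ModuleCat.{u} S → Prop)
    (M : Type u) [AddCommGroup M] [Module S M] (n : ℕ) : Prop :=
  ∃ (G : ℕ → ModuleCat.{u} S) (d : ∀ i : ℕ, G (i + 1) →ₗ[S] G i) (ε : G 0 →ₗ[S] M),
    (∀ i ≤ n, P (G i)) ∧ (∀ i, n < i → Subsingleton (G i)) ∧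
    Function.Surjective ε ∧ Function.Exact (d 0) ε ∧
    ∀ i, Function.Exact (d (i + 1)) (d i)

variable (R : Type u) [Ring R]

/-- The Gorenstein flat dimension of a left `R`-module: the least length of a resolution by
Gorenstein flat modules, and `⊤` if there is no such resolution of finite length. -/
noncomputable def gfd (M : Type u) [AddCommGroup M] [Module R M] : ℕ∞ :=
  ⨅ (n : ℕ) (_ : HasResolutionLE R (fun G => IsGorensteinFlat R G) M n), (n : ℕ∞)

/-- The flat dimension of a right `R`-module: the least length of a resolution by
flat modules, and `⊤` if there is no such resolution of finite length. -/
noncomputable def fdRight (E : Type u) [AddCommGroup E] [Module Rᵐᵒᵖ E] : ℕ∞ :=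
  ⨅ (n : ℕ) (_ : HasResolutionLE Rᵐᵒᵖ (fun G => IsFlatRight R G) E n), (n : ℕ∞)

/-- The left weak Gorenstein global dimension of `R`. -/
noncomputable def lGwdim : ℕ∞ :=
  ⨆ M : ModuleCat.{u} R, gfd R M

end Dimension

end WeakGorenstein

/-!
`Tor` over the noncommutative ring `R` is replaced throughout by `Ext`, via character modules
`M⁺ = Hom_ℤ(M, ℚ/ℤ)`: the dual of `Tor_i(A, B)` is both `Ext^i(A, B⁺)` and `Ext^i(B, A⁺)`
(`extZero_charDual_swap`), a module is flat if and only if its character module is injective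
(`isFlatLeft_iff`, `isFlatRight_iff`), and the flat dimension of a right module `E` is the injective
dimension of `E⁺` (`fdRight_le_iff`).

A Gorenstein flat module `G` satisfies `Tor_i(E, G) = 0` for all `i ≥ 1` and all injective right
modules `E`.  So if `Gfd (R ⧸ I) ≤ n` for all finitely generated left ideals `I`, then
`Tor_{n+1}(E, R ⧸ I) = 0`, which is enough to bound the flat dimension of `E` by `n`
(`hasInjectiveDimensionLT_of_extZero_fg`).  Dimension shifting extends this bound from injective
modules to all right modules of finite injective dimension.

The remaining point is that a bound `n` on the flat dimensions of all injective right modules bounds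
the Gorenstein flat dimension of every `M`.  The `n`-th syzygy `K` of `M` satisfies
`Tor_i(E, K) = 0` for all `i ≥ 1` and all injective `E`, and it has finite Gorenstein flat dimension
by hypothesis.  Closure under extensions then gives a short exact sequence `K → L → G` in which `L`
has finite flat dimension and `G` is Gorenstein flat (`exists_embedding_of_hasResolutionLE`).  Now
`L⁺` has finite injective dimension and is `Ext`-orthogonal to all injective modules, so it is
injective (`injective_of_extZero_injective`), that is, `L` is flat.  Thus `K` embeds into a flat
module with a cokernel of the same kind, and splicing such sequences with a projective resolution
gives a complete flat resolution of `K` (`isGorensteinFlat_of_torOrthogonal`).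

The formulas for the suprema hold because an element of `ℕ∞` is determined by the natural numbers
above it.
-/

namespace WeakGorenstein

/-! ### Character modules over the opposite ring -/

section CharacterDual

/-- A ring homomorphism `T → Sᵐᵒᵖ`, through which characters of a left `S`-module form a left
`T`-module.  It is used for `T = Sᵐᵒᵖ` and for `S = Tᵐᵒᵖ`, so that left and right modules can be
treated at once. -/
class OppositeHom (S T : Type u) [Ring S] [Ring T] where
  /-- The homomorphism `T → Sᵐᵒᵖ`. -/
  toOp : T →+* Sᵐᵒᵖ

/-- The anti-homomorphism `T → S` underlying `OppositeHom.toOp`. -/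
def swap (S T : Type u) [Ring S] [Ring T] [OppositeHom S T] (t : T) : S :=
  unop (OppositeHom.toOp t)

/-- The anti-homomorphism `T → S` is a left inverse of `S → T`.  Assumed in both directions, it
says that `S` and `T` are opposite rings of each other. -/
class OppositePair (S T : Type u) [Ring S] [Ring T] [OppositeHom S T] [OppositeHom T S] :
    Prop where
  swap_swap (s : S) : swap S T (swap T S s) = s

instance (R : Type u) [Ring R] : OppositeHom R Rᵐᵒᵖ := ⟨RingHom.id _⟩

instance (R : Type u) [Ring R] : OppositeHom Rᵐᵒᵖ R := ⟨(RingEquiv.opOp R).toRingHom⟩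

instance (R : Type u) [Ring R] : OppositePair R Rᵐᵒᵖ := ⟨fun _ => rfl⟩

instance (R : Type u) [Ring R] : OppositePair Rᵐᵒᵖ R := ⟨fun _ => rfl⟩

/-- The character module `Hom_ℤ(B, ℚ/ℤ)` of a left `S`-module `B`, as a module over the opposite
ring `T`. -/
def CharDual (S T : Type u) [Ring S] [Ring T] [OppositeHom S T] (B : Type u) [AddCommGroup B]
    [Module S B] : Type u :=
  CharacterModule B

variable (S T : Type u) [Ring S] [Ring T] [OppositeHom S T]
  {A B C : Type u} [AddCommGroup A] [AddCommGroup B] [AddCommGroup C]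
  [Module S A] [Module S B] [Module S C]

instance : AddCommGroup (CharDual S T B) := inferInstanceAs (AddCommGroup (CharacterModule B))

instance : FunLike (CharDual S T B) B (AddCircle (1 : ℚ)) :=
  inferInstanceAs (FunLike (CharacterModule B) B (AddCircle (1 : ℚ)))

instance : AddMonoidHomClass (CharDual S T B) B (AddCircle (1 : ℚ)) :=
  inferInstanceAs (AddMonoidHomClass (B →+ AddCircle (1 : ℚ)) B (AddCircle (1 : ℚ)))

variable {S T}

@[ext] theorem CharDual.ext {χ ψ : CharDual S T B} (h : ∀ b, χ b = ψ b) : χ = ψ :=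
  DFunLike.ext _ _ h

@[simp] theorem CharDual.add_apply (χ ψ : CharDual S T B) (b : B) : (χ + ψ) b = χ b + ψ b := rfl

@[simp] theorem CharDual.zero_apply (b : B) : (0 : CharDual S T B) b = 0 := rfl

variable (S T) in
/-- An additive character, as an element of the character module. -/
def CharDual.mk (χ : B →+ AddCircle (1 : ℚ)) : CharDual S T B := χ

noncomputable instance : Module T (CharDual S T B) where
  smul t χ := CharDual.mk S T
    ((χ : B →+ AddCircle (1 : ℚ)).comp (DistribSMul.toAddMonoidHom B (swap S T t)))
  one_smul χ := by
    ext b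
    change χ (swap S T (1 : T) • b) = χ b
    simp [swap]
  mul_smul t t' χ := by
    ext b
    change χ (swap S T (t * t') • b) = χ (swap S T t' • swap S T t • b)
    simp [swap, mul_smul]
  smul_zero t := rfl
  smul_add t χ ψ := rfl
  add_smul t t' χ := by
    ext b
    change χ (swap S T (t + t') • b) = χ (swap S T t • b) + χ (swap S T t' • b)
    simp [swap, add_smul]
  zero_smul χ := by
    ext b
    change χ (swap S T (0 : T) • b) = 0
    simp [swap]

@[simp] theorem CharDual.smul_apply (t : T) (χ : CharDual S T B) (b : B) :
    (t • χ) b = χ (swap S T t • b) := rfl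

variable (T) in
/-- Precomposition with `f`, as a map of character modules. -/
def dualMap (f : A →ₗ[S] B) : CharDual S T B →ₗ[T] CharDual S T A where
  toFun χ := CharDual.mk S T ((χ : B →+ AddCircle (1 : ℚ)).comp f.toAddMonoidHom)
  map_add' _ _ := rfl
  map_smul' t χ := by
    ext a
    change χ (swap S T t • f a) = χ (f (swap S T t • a))
    rw [f.map_smul]

@[simp] theorem dualMap_apply (f : A →ₗ[S] B) (χ : CharDual S T B) (a : A) :
    dualMap T f χ a = χ (f a) := rfl

/-- `0 → A → B → C → 0` is a short exact sequence. -/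
structure IsSES {S : Type u} [Ring S] {A B C : Type u} [AddCommGroup A] [AddCommGroup B]
    [AddCommGroup C] [Module S A] [Module S B] [Module S C]
    (f : A →ₗ[S] B) (g : B →ₗ[S] C) : Prop where
  injective : Function.Injective f
  surjective : Function.Surjective g
  exact : Function.Exact f g

/-- A sequence of abelian groups is exact as soon as, and only if, its dual sequence is. -/
theorem exact_iff_characters {X Y Z : Type u} [AddCommGroup X] [AddCommGroup Y] [AddCommGroup Z]
    (f : X →+ Y) (g : Y →+ Z) :
    Function.Exact f g ↔ ∀ χ : Y →+ AddCircle (1 : ℚ),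
      (∀ x, χ (f x) = 0) ↔ ∃ ψ : Z →+ AddCircle (1 : ℚ), ∀ y, ψ (g y) = χ y := by
  constructor
  · intro h χ
    constructor
    · intro hχ
      -- `χ` factors through the image of `g`, and extends to `Z` since `ℚ/ℤ` is injective
      have hker : g.ker ≤ χ.ker := by
        intro y hy
        obtain ⟨x, rfl⟩ := (h y).1 hy
        exact hχ x
      obtain ⟨ψ, hψ⟩ := CharacterModule.dual_surjective_of_injective
        (R := ℤ) (QuotientAddGroup.kerLift g).toIntLinearMap
        (QuotientAddGroup.kerLift_injective g) (QuotientAddGroup.lift g.ker χ hker)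
      refine ⟨ψ, fun y => ?_⟩
      exact DFunLike.congr_fun hψ (y : Y ⧸ g.ker)
    · rintro ⟨ψ, hψ⟩ x
      rw [← hψ, (h (f x)).2 ⟨x, rfl⟩, map_zero]
  · intro h y
    constructor
    · intro hy
      by_contra hn
      have hne : (QuotientAddGroup.mk y : Y ⧸ f.range) ≠ 0 := by
        rw [Ne, QuotientAddGroup.eq_zero_iff]
        exact hn
      obtain ⟨c, hc⟩ : ∃ c : Y ⧸ f.range →+ AddCircle (1 : ℚ), c (QuotientAddGroup.mk y) ≠ 0 :=
        CharacterModule.exists_character_apply_ne_zero_of_ne_zero hne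
      obtain ⟨ψ, hψ⟩ := (h (c.comp (QuotientAddGroup.mk' f.range))).1 (by
        intro x
        have : QuotientAddGroup.mk' f.range (f x) = 0 :=
          (QuotientAddGroup.eq_zero_iff _).2 ⟨x, rfl⟩
        rw [AddMonoidHom.comp_apply, this, map_zero])
      apply hc
      have := hψ y
      rw [hy, map_zero] at this
      exact this.symm
    · rintro ⟨x, rfl⟩
      refine CharacterModule.eq_zero_of_character_apply fun c => ?_
      exact (h (AddMonoidHom.comp c g)).2 ⟨c, fun _ => rfl⟩ x

theorem injective_iff_characters {X Y : Type u} [AddCommGroup X] [AddCommGroup Y] (f : X →+ Y) :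
    Function.Injective f ↔ ∀ χ : X →+ AddCircle (1 : ℚ),
      ∃ ψ : Y →+ AddCircle (1 : ℚ), ∀ x, ψ (f x) = χ x := by
  rw [show Function.Injective f ↔ Function.Injective f.toIntLinearMap from Iff.rfl,
    ← CharacterModule.dual_surjective_iff_injective]
  exact forall_congr' fun χ => exists_congr fun ψ => DFunLike.ext_iff

theorem IsSES.dual {f : A →ₗ[S] B} {g : B →ₗ[S] C} (h : IsSES f g) :
    IsSES (dualMap T g) (dualMap T f) where
  injective := fun χ ψ hχ => by
    ext c
    obtain ⟨b, rfl⟩ := h.surjective c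
    exact DFunLike.congr_fun hχ b
  surjective := fun χ => by
    obtain ⟨ψ, hψ⟩ := (injective_iff_characters f.toAddMonoidHom).1 h.injective χ
    exact ⟨ψ, CharDual.ext hψ⟩
  exact := fun χ => by
    refine Iff.trans ?_ (((exact_iff_characters f.toAddMonoidHom g.toAddMonoidHom).1
      h.exact χ).trans ?_)
    · exact DFunLike.ext_iff
    · exact exists_congr fun ψ => ⟨fun hψ => CharDual.ext hψ, fun hψ b => DFunLike.congr_fun hψ b⟩

end CharacterDual

section Transpose

variable {S T : Type u} [Ring S] [Ring T] [OppositeHom S T] [OppositeHom T S]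

variable [OppositePair S T] {A B : Type u} [AddCommGroup A] [AddCommGroup B]
  [Module T A] [Module S B]

/-- The adjunction `Hom_T(A, B⁺) → Hom_S(B, A⁺)` exchanging the two arguments of a balanced
biadditive map `A × B → ℚ/ℤ`. -/
noncomputable def transpose (φ : A →ₗ[T] CharDual S T B) : B →ₗ[S] CharDual T S A where
  toFun b := CharDual.mk T S
    { toFun := fun a => φ a b
      map_zero' := by simp
      map_add' := by simp }
  map_add' b b' := by
    ext a
    exact map_add (φ a) b b'
  map_smul' s b := by
    ext a
    change φ a (s • b) = φ (swap T S s • a) b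
    rw [φ.map_smul, CharDual.smul_apply, OppositePair.swap_swap]

end Transpose

/-! ### Characters of balanced tensor products -/

section BalancedTensor

variable {R : Type u} [Ring R] {A A' B B' B'' : Type u}
  [AddCommGroup A] [Module Rᵐᵒᵖ A] [AddCommGroup A'] [Module Rᵐᵒᵖ A']
  [AddCommGroup B] [Module R B] [AddCommGroup B'] [Module R B'] [AddCommGroup B''] [Module R B'']

variable (R) in
/-- The pure tensor `a ⊗ b` in `A ⊗_R B`. -/
def BalTensor.tmul (a : A) (b : B) : BalTensor R A B :=
  QuotientAddGroup.mk (a ⊗ₜ[ℤ] b)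

theorem BalTensor.map_tmul (f : A →ₗ[Rᵐᵒᵖ] A') (g : B →ₗ[R] B') (a : A) (b : B) :
    BalTensor.map R f g (BalTensor.tmul R a b) = BalTensor.tmul R (f a) (g b) := rfl

theorem BalTensor.induction_on {p : BalTensor R A B → Prop} (x : BalTensor R A B) (zero : p 0)
    (tmul : ∀ a b, p (BalTensor.tmul R a b)) (add : ∀ x y, p x → p y → p (x + y)) : p x := by
  induction x using QuotientAddGroup.induction_on with
  | H z =>
    induction z using TensorProduct.induction_on with
    | zero => exact zero
    | tmul a b => exact tmul a b
    | add x y hx hy => exact add _ _ hx hy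

theorem BalTensor.smul_tmul (a : A) (r : R) (b : B) :
    BalTensor.tmul R (op r • a) b = BalTensor.tmul R a (r • b) := by
  refine (QuotientAddGroup.eq_iff_sub_mem).2 (AddSubgroup.subset_closure ⟨a, r, b, rfl⟩)

/-- A character of `A ⊗_R B`, as a linear map `A → B⁺`. -/
noncomputable def balCurry (χ : BalTensor R A B →+ AddCircle (1 : ℚ)) :
    A →ₗ[Rᵐᵒᵖ] CharDual R Rᵐᵒᵖ B where
  toFun a := CharDual.mk R Rᵐᵒᵖ
    (χ.comp ((QuotientAddGroup.mk' _).comp (TensorProduct.mk ℤ A B a).toAddMonoidHom))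
  map_add' a a' := by
    ext b
    change χ (QuotientAddGroup.mk ((a + a') ⊗ₜ[ℤ] b)) =
      χ (QuotientAddGroup.mk (a ⊗ₜ[ℤ] b)) + χ (QuotientAddGroup.mk (a' ⊗ₜ[ℤ] b))
    rw [TensorProduct.add_tmul, QuotientAddGroup.mk_add, map_add]
  map_smul' r a := by
    ext b
    exact congrArg χ (BalTensor.smul_tmul a r.unop b)

theorem balCurry_apply (χ : BalTensor R A B →+ AddCircle (1 : ℚ)) (a : A) (b : B) :
    balCurry χ a b = χ (BalTensor.tmul R a b) := rfl

theorem balCurry_surjective (φ : A →ₗ[Rᵐᵒᵖ] CharDual R Rᵐᵒᵖ B) :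
    ∃ χ : BalTensor R A B →+ AddCircle (1 : ℚ),
      ∀ a b, χ (BalTensor.tmul R a b) = φ a b := by
  let ψ : A ⊗[ℤ] B →+ AddCircle (1 : ℚ) :=
    TensorProduct.liftAddHom
      { toFun := fun a => (φ a : B →+ AddCircle (1 : ℚ))
        map_zero' := by rw [map_zero]; rfl
        map_add' := fun a a' => by rw [map_add]; rfl }
      (fun z a b => by
        change φ (z • a) b = φ a (z • b)
        rw [map_zsmul, map_zsmul]
        exact (map_zsmul (⟨⟨fun χ : CharDual R Rᵐᵒᵖ B => χ b, rfl⟩, fun _ _ => rfl⟩ :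
          CharDual R Rᵐᵒᵖ B →+ AddCircle (1 : ℚ)) z (φ a)))
  refine ⟨QuotientAddGroup.lift _ ψ ?_, fun a b => rfl⟩
  refine (AddSubgroup.closure_le _).2 ?_
  rintro _ ⟨a, r, b, rfl⟩
  change ψ _ = 0
  rw [map_sub, sub_eq_zero]
  change φ (op r • a) b = φ a (r • b)
  rw [map_smul]
  rfl

theorem balTensor_addHom_ext {X : Type*} [AddCommGroup X] {χ ψ : BalTensor R A B →+ X}
    (h : ∀ a b, χ (BalTensor.tmul R a b) = ψ (BalTensor.tmul R a b)) (x : BalTensor R A B) :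
    χ x = ψ x := by
  induction x using BalTensor.induction_on with
  | zero => simp
  | tmul a b => exact h a b
  | add x y hx hy => rw [map_add, map_add, hx, hy]

theorem BalTensor.map_id_comp (f : B →ₗ[R] B') (g : B' →ₗ[R] B'') (h : B →ₗ[R] B'')
    (hgf : ∀ b, g (f b) = h b) (x : BalTensor R A B) :
    BalTensor.map R (LinearMap.id : A →ₗ[Rᵐᵒᵖ] A) g (BalTensor.map R LinearMap.id f x) =
      BalTensor.map R LinearMap.id h x := by
  refine balTensor_addHom_ext (χ := (BalTensor.map R LinearMap.id g).comp
    (BalTensor.map R LinearMap.id f)) (ψ := BalTensor.map R LinearMap.id h) (fun a b => ?_) x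
  rw [AddMonoidHom.comp_apply, BalTensor.map_tmul, BalTensor.map_tmul, BalTensor.map_tmul, hgf]
  rfl

/-- By the tensor-hom adjunction, `f ⊗ g` is injective if and only if the map it induces on
`Hom_{Rᵐᵒᵖ}(-, -⁺)` is surjective. -/
theorem map_injective_iff (f : A →ₗ[Rᵐᵒᵖ] A') (g : B →ₗ[R] B') :
    Function.Injective (BalTensor.map R f g) ↔ ∀ φ : A →ₗ[Rᵐᵒᵖ] CharDual R Rᵐᵒᵖ B,
      ∃ ψ : A' →ₗ[Rᵐᵒᵖ] CharDual R Rᵐᵒᵖ B', ∀ a b, ψ (f a) (g b) = φ a b := by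
  rw [injective_iff_characters]
  constructor
  · intro h φ
    obtain ⟨χ, hχ⟩ := balCurry_surjective φ
    obtain ⟨ψ, hψ⟩ := h χ
    refine ⟨balCurry ψ, fun a b => ?_⟩
    rw [← hχ, ← hψ]
    rfl
  · intro h χ
    obtain ⟨ψ, hψ⟩ := h (balCurry χ)
    obtain ⟨ψ', hψ'⟩ := balCurry_surjective ψ
    refine ⟨ψ', balTensor_addHom_ext (χ := ψ'.comp (BalTensor.map R f g)) fun a b => ?_⟩
    rw [AddMonoidHom.comp_apply, BalTensor.map_tmul, hψ', hψ, balCurry_apply]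

/-- By the tensor-hom adjunction, `A ⊗_R B → A ⊗_R B' → A ⊗_R B''` is exact if and only if
`Hom_{Rᵐᵒᵖ}(A, -⁺)` turns `B → B' → B''` into an exact sequence. -/
theorem map_exact_iff (f : B →ₗ[R] B') (g : B' →ₗ[R] B'') :
    Function.Exact (BalTensor.map R (LinearMap.id : A →ₗ[Rᵐᵒᵖ] A) f)
      (BalTensor.map R (LinearMap.id : A →ₗ[Rᵐᵒᵖ] A) g) ↔
    ∀ φ : A →ₗ[Rᵐᵒᵖ] CharDual R Rᵐᵒᵖ B', (∀ a b, φ a (f b) = 0) ↔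
      ∃ ψ : A →ₗ[Rᵐᵒᵖ] CharDual R Rᵐᵒᵖ B'', ∀ a b, ψ a (g b) = φ a b := by
  rw [exact_iff_characters]
  have key : ∀ (χ : BalTensor R A B' →+ AddCircle (1 : ℚ))
      (φ : A →ₗ[Rᵐᵒᵖ] CharDual R Rᵐᵒᵖ B'), (∀ a b, χ (BalTensor.tmul R a b) = φ a b) →
      (((∀ x, χ (BalTensor.map R (LinearMap.id : A →ₗ[Rᵐᵒᵖ] A) f x) = 0) ↔
        ∃ ψ : BalTensor R A B'' →+ AddCircle (1 : ℚ),
          ∀ y, ψ (BalTensor.map R (LinearMap.id : A →ₗ[Rᵐᵒᵖ] A) g y) = χ y) ↔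
      ((∀ a b, φ a (f b) = 0) ↔
        ∃ ψ : A →ₗ[Rᵐᵒᵖ] CharDual R Rᵐᵒᵖ B'', ∀ a b, ψ a (g b) = φ a b)) := by
    intro χ φ h
    refine iff_congr ⟨fun h0 a b => ?_, fun h0 => ?_⟩ ⟨?_, ?_⟩
    · rw [← h]
      exact h0 (BalTensor.tmul R a b)
    · refine balTensor_addHom_ext (χ := χ.comp (BalTensor.map R _ f)) (ψ := 0) fun a b => ?_
      exact (h a (f b)).trans (h0 a b)
    · rintro ⟨ψ, hψ⟩
      refine ⟨balCurry ψ, fun a b => ?_⟩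
      rw [← h, ← hψ]
      rfl
    · rintro ⟨ψ, hψ⟩
      obtain ⟨ψ', hψ'⟩ := balCurry_surjective ψ
      refine ⟨ψ', balTensor_addHom_ext (χ := ψ'.comp (BalTensor.map R _ g)) fun a b => ?_⟩
      rw [AddMonoidHom.comp_apply, BalTensor.map_tmul, hψ', h, ← hψ]
      rfl
  constructor
  · intro h φ
    obtain ⟨χ, hχ⟩ := balCurry_surjective φ
    exact (key χ φ hχ).1 (h χ)
  · intro h χ
    exact (key χ (balCurry χ) fun _ _ => rfl).2 (h _)

end BalancedTensor

/-! ### Flatness as injectivity of the character module -/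

section Flat

variable {R : Type u} [Ring R]

/-- Lambek's criterion: a left module is flat if and only if its character module is injective. -/
theorem isFlatLeft_iff (M : Type u) [AddCommGroup M] [Module R M] :
    IsFlatLeft R M ↔ Module.Injective Rᵐᵒᵖ (CharDual R Rᵐᵒᵖ M) := by
  constructor
  · intro h
    refine ⟨fun X Y _ _ _ _ f hf φ => ?_⟩
    obtain ⟨ψ, hψ⟩ := (map_injective_iff f (LinearMap.id : M →ₗ[R] M)).1
      (h (ModuleCat.of _ X) (ModuleCat.of _ Y) f hf) φ
    exact ⟨ψ, fun x => CharDual.ext fun b => hψ x b⟩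
  · intro h A B f hf
    refine (map_injective_iff _ _).2 fun φ => ?_
    obtain ⟨ψ, hψ⟩ := h.out f hf φ
    exact ⟨ψ, fun a b => DFunLike.congr_fun (hψ a) b⟩

/-- Lambek's criterion for right modules.  Flatness of `E` concerns maps in the second argument of
`E ⊗_R -`, so the adjunction has to be used on the other side. -/
theorem isFlatRight_iff (E : Type u) [AddCommGroup E] [Module Rᵐᵒᵖ E] :
    IsFlatRight R E ↔ Module.Injective R (CharDual Rᵐᵒᵖ R E) := by
  constructor
  · intro h
    refine ⟨fun X Y _ _ _ _ f hf φ => ?_⟩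
    obtain ⟨ψ, hψ⟩ := (map_injective_iff (LinearMap.id : E →ₗ[Rᵐᵒᵖ] E) f).1
      (h (ModuleCat.of _ X) (ModuleCat.of _ Y) f hf) (transpose φ)
    exact ⟨transpose ψ, fun x => CharDual.ext fun b => hψ b x⟩
  · intro h A B f hf
    refine (map_injective_iff _ _).2 fun φ => ?_
    obtain ⟨ψ, hψ⟩ := h.out f hf (transpose φ)
    exact ⟨transpose ψ, fun a b => DFunLike.congr_fun (hψ b) a⟩

/-- The tensor products `K ⊗_R I` over the finitely generated left ideals `I` exhaust those over
all left ideals. -/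
theorem BalTensor.exists_fg_of_submodule {E : Type u} [AddCommGroup E] [Module Rᵐᵒᵖ E]
    {I : Submodule R R} (x : BalTensor R E I) :
    ∃ (J : Submodule R R) (hJ : J ≤ I), J.FG ∧
      x ∈ (BalTensor.map R (LinearMap.id : E →ₗ[Rᵐᵒᵖ] E) (Submodule.inclusion hJ)).range := by
  induction x using BalTensor.induction_on with
  | zero => exact ⟨⊥, bot_le, Submodule.fg_bot, zero_mem _⟩
  | tmul a b =>
    refine ⟨Submodule.span R {(b : R)}, (Submodule.span_singleton_le_iff_mem _ _).2 b.2,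
      Submodule.fg_span_singleton _,
      BalTensor.tmul R a ⟨b, Submodule.mem_span_singleton_self _⟩, rfl⟩
  | add x y hx hy =>
    obtain ⟨J, hJ, hJfg, x, rfl⟩ := hx
    obtain ⟨J', hJ', hJfg', y, rfl⟩ := hy
    refine ⟨J ⊔ J', sup_le hJ hJ', hJfg.sup hJfg', add_mem ?_ ?_⟩
    · exact ⟨BalTensor.map R LinearMap.id (Submodule.inclusion le_sup_left) x,
        BalTensor.map_id_comp _ _ _ (fun _ => rfl) x⟩
    · exact ⟨BalTensor.map R LinearMap.id (Submodule.inclusion le_sup_right) y,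
        BalTensor.map_id_comp _ _ _ (fun _ => rfl) y⟩

/-- Baer's criterion for `E⁺` needs only be tested on finitely generated left ideals. -/
theorem injective_charDual_of_fg (E : Type u) [AddCommGroup E] [Module Rᵐᵒᵖ E]
    (h : ∀ I : Submodule R R, I.FG → ∀ φ : I →ₗ[R] CharDual Rᵐᵒᵖ R E,
      ∃ ψ : R →ₗ[R] CharDual Rᵐᵒᵖ R E, ∀ x : I, ψ x = φ x) :
    Module.Injective R (CharDual Rᵐᵒᵖ R E) := by
  have hfg : ∀ I : Submodule R R, I.FG →
      Function.Injective (BalTensor.map R (LinearMap.id : E →ₗ[Rᵐᵒᵖ] E) I.subtype) := by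
    intro I hI
    refine (map_injective_iff _ _).2 fun φ => ?_
    obtain ⟨ψ, hψ⟩ := h I hI (transpose φ)
    exact ⟨transpose ψ, fun a b => DFunLike.congr_fun (hψ b) a⟩
  have hall : ∀ I : Submodule R R,
      Function.Injective (BalTensor.map R (LinearMap.id : E →ₗ[Rᵐᵒᵖ] E) I.subtype) := by
    intro I
    refine (injective_iff_map_eq_zero _).2 fun x hx => ?_
    obtain ⟨J, hJ, hJfg, y, rfl⟩ := BalTensor.exists_fg_of_submodule x
    have : y = 0 := by
      refine (injective_iff_map_eq_zero _).1 (hfg J hJfg) y (Eq.trans ?_ hx)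
      exact (BalTensor.map_id_comp _ _ _ (fun _ => rfl) y).symm
    rw [this, map_zero]
  refine Module.Baer.injective fun I φ => ?_
  obtain ⟨ψ, hψ⟩ := (map_injective_iff _ _).1 (hall I) (transpose φ)
  exact ⟨transpose ψ, fun x hx => CharDual.ext fun b => hψ b ⟨x, hx⟩⟩

end Flat

/-! ### Vanishing of `Ext` along short exact sequences -/

open Abelian

section Ext

/-- `Ext^i_S(A, B) = 0`. -/
abbrev ExtZero (S : Type u) [Ring S] (A B : Type u) [AddCommGroup A] [AddCommGroup B] [Module S A]
    [Module S B] (i : ℕ) : Prop :=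
  Subsingleton (Ext.{u} (ModuleCat.of S A) (ModuleCat.of S B) i)

variable {S : Type u} [Ring S] {A B C : Type u} [AddCommGroup A] [AddCommGroup B] [AddCommGroup C]
  [Module S A] [Module S B] [Module S C] {f : A →ₗ[S] B} {g : B →ₗ[S] C}

/-- A short exact sequence of modules, as a short complex in the category of modules. -/
abbrev IsSES.complex (h : IsSES f g) : ShortComplex (ModuleCat.{u} S) :=
  ModuleCat.shortComplexOfCompEqZero f g h.exact.linearMap_comp_eq_zero

theorem IsSES.shortExact (h : IsSES f g) : h.complex.ShortExact :=
  ModuleCat.shortComplex_shortExact h.complex h.exact h.injective h.surjective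

variable {Y : Type u} [AddCommGroup Y] [Module S Y]

theorem extZero_of_forall {i : ℕ}
    (h : ∀ x : Ext.{u} (ModuleCat.of S A) (ModuleCat.of S B) i, x = 0) : ExtZero S A B i :=
  subsingleton_of_forall_eq 0 h

theorem IsSES.extZero_left (h : IsSES f g) {i : ℕ} (hC : ExtZero S Y C i)
    (hB : ExtZero S Y B (i + 1)) : ExtZero S Y A (i + 1) := by
  refine extZero_of_forall fun x => ?_
  obtain ⟨y, rfl⟩ := Ext.covariant_sequence_exact₁ _ h.shortExact x (hB.elim _ _) rfl
  rw [hC.elim y 0, Ext.zero_comp]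

theorem IsSES.extZero_mid (h : IsSES f g) {i : ℕ} (hA : ExtZero S Y A i)
    (hC : ExtZero S Y C i) : ExtZero S Y B i := by
  refine extZero_of_forall fun x => ?_
  obtain ⟨y, rfl⟩ := Ext.covariant_sequence_exact₂ _ h.shortExact x (hC.elim _ _)
  rw [hA.elim y 0, Ext.zero_comp]

theorem IsSES.extZero_right (h : IsSES f g) {i : ℕ} (hB : ExtZero S Y B i)
    (hA : ExtZero S Y A (i + 1)) : ExtZero S Y C i := by
  refine extZero_of_forall fun x => ?_
  obtain ⟨y, rfl⟩ := Ext.covariant_sequence_exact₃ _ h.shortExact x rfl (hA.elim _ _)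
  rw [hB.elim y 0, Ext.zero_comp]

theorem IsSES.extZero_right' (h : IsSES f g) {i : ℕ} (hA : ExtZero S A Y i)
    (hB : ExtZero S B Y (i + 1)) : ExtZero S C Y (i + 1) := by
  refine extZero_of_forall fun x => ?_
  obtain ⟨y, rfl⟩ := Ext.contravariant_sequence_exact₃ h.shortExact _ x (hB.elim _ _)
    (add_comm 1 i)
  rw [hA.elim y 0, Ext.comp_zero]

theorem IsSES.extZero_left' (h : IsSES f g) {i : ℕ} (hB : ExtZero S B Y i)
    (hC : ExtZero S C Y (i + 1)) : ExtZero S A Y i := by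
  refine extZero_of_forall fun x => ?_
  obtain ⟨y, rfl⟩ := Ext.contravariant_sequence_exact₁ h.shortExact _ x (add_comm 1 i)
    (hC.elim _ _)
  rw [hB.elim y 0, Ext.comp_zero]

theorem IsSES.exists_lift (h : IsSES f g) (hA : ExtZero S Y A 1) (φ : Y →ₗ[S] C) :
    ∃ ψ : Y →ₗ[S] B, ∀ y, g (ψ y) = φ y := by
  obtain ⟨x, hx⟩ := Ext.covariant_sequence_exact₃ _ h.shortExact
    (Ext.mk₀ (ModuleCat.ofHom φ)) (zero_add 1) (hA.elim _ _)
  obtain ⟨ψ, rfl⟩ := Ext.homEquiv₀.symm.surjective x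
  have : ψ ≫ ModuleCat.ofHom g = ModuleCat.ofHom φ :=
    Ext.homEquiv₀.symm.injective (by simpa using hx)
  refine ⟨ψ.hom, fun y => ?_⟩
  exact congrArg (fun k => k.hom y) this

theorem IsSES.extZero_one_of_lift (h : IsSES f g) (hB : ExtZero S Y B 1)
    (hl : ∀ φ : Y →ₗ[S] C, ∃ ψ : Y →ₗ[S] B, ∀ y, g (ψ y) = φ y) : ExtZero S Y A 1 := by
  refine extZero_of_forall fun x => ?_
  obtain ⟨y, rfl⟩ := Ext.covariant_sequence_exact₁ _ h.shortExact x (hB.elim _ _) (zero_add 1)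
  obtain ⟨φ, rfl⟩ := Ext.homEquiv₀.symm.surjective y
  obtain ⟨ψ, hψ⟩ := hl φ.hom
  have : φ = ModuleCat.ofHom ψ ≫ h.complex.g := by
    ext y
    exact (hψ y).symm
  rw [this, Ext.homEquiv₀_symm_apply, ← Ext.mk₀_comp_mk₀, Ext.comp_assoc_of_second_deg_zero,
    h.shortExact.comp_extClass, Ext.comp_zero]

theorem IsSES.exists_extend (h : IsSES f g) (hC : ExtZero S C Y 1) (φ : A →ₗ[S] Y) :
    ∃ ψ : B →ₗ[S] Y, ∀ a, ψ (f a) = φ a := by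
  obtain ⟨x, hx⟩ := Ext.contravariant_sequence_exact₁ h.shortExact _
    (Ext.mk₀ (ModuleCat.ofHom φ)) (add_zero 1) (hC.elim _ _)
  obtain ⟨ψ, rfl⟩ := Ext.homEquiv₀.symm.surjective x
  have : ModuleCat.ofHom f ≫ ψ = ModuleCat.ofHom φ :=
    Ext.homEquiv₀.symm.injective (by simpa using hx)
  refine ⟨ψ.hom, fun y => ?_⟩
  exact congrArg (fun k => k.hom y) this

theorem IsSES.extZero_one_of_extend (h : IsSES f g) (hB : ExtZero S B Y 1)
    (he : ∀ φ : A →ₗ[S] Y, ∃ ψ : B →ₗ[S] Y, ∀ a, ψ (f a) = φ a) : ExtZero S C Y 1 := by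
  refine extZero_of_forall fun x => ?_
  obtain ⟨y, rfl⟩ := Ext.contravariant_sequence_exact₃ h.shortExact _ x (hB.elim _ _) (add_zero 1)
  obtain ⟨φ, rfl⟩ := Ext.homEquiv₀.symm.surjective y
  obtain ⟨ψ, hψ⟩ := he φ.hom
  have : φ = h.complex.f ≫ ModuleCat.ofHom ψ := by
    ext y
    exact (hψ y).symm
  rw [this, Ext.homEquiv₀_symm_apply, ← Ext.mk₀_comp_mk₀, ← Ext.comp_assoc_of_second_deg_zero,
    h.shortExact.extClass_comp, Ext.zero_comp]

theorem extZero_of_injective (A E : Type u) [AddCommGroup A] [AddCommGroup E] [Module S A]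
    [Module S E] [hE : Module.Injective S E] (i : ℕ) : ExtZero S A E (i + 1) := by
  have := Module.injective_object_of_injective_module S E
  exact extZero_of_forall fun x => x.eq_zero_of_injective

theorem extZero_of_projective (P A : Type u) [AddCommGroup A] [AddCommGroup P] [Module S A]
    [Module S P] [Module.Projective S P] (i : ℕ) : ExtZero S P A (i + 1) := by
  have : Projective (ModuleCat.of S P) := (IsProjective.iff_projective P).1 inferInstance
  exact extZero_of_forall fun x => x.eq_zero_of_projective

theorem isSES_ker (g : B →ₗ[S] C) (hg : Function.Surjective g) :
    IsSES (LinearMap.ker g).subtype g :=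
  ⟨Submodule.subtype_injective _, hg, LinearMap.exact_subtype_ker_map g⟩

theorem isSES_coker (f : A →ₗ[S] B) (hf : Function.Injective f) :
    IsSES f (LinearMap.range f).mkQ :=
  ⟨hf, Submodule.mkQ_surjective _, LinearMap.exact_map_mkQ_range f⟩

theorem isSES_submodule (N : Submodule S B) : IsSES N.subtype N.mkQ :=
  ⟨Submodule.subtype_injective _, Submodule.mkQ_surjective _, LinearMap.exact_subtype_mkQ N⟩

variable (S) in
theorem exists_projective_cover (M : Type u) [AddCommGroup M] [Module S M] :
    ∃ (K P : ModuleCat.{u} S) (f : K →ₗ[S] P) (g : P →ₗ[S] M), Module.Projective S P ∧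
      IsSES f g := by
  refine ⟨ModuleCat.of S (LinearMap.ker (Finsupp.linearCombination S (id : M → M))),
    ModuleCat.of S (M →₀ S), (LinearMap.ker (Finsupp.linearCombination S (id : M → M))).subtype,
    Finsupp.linearCombination S (id : M → M), ?_, isSES_ker _ ?_⟩
  · exact Module.Projective.of_free
  · exact Finsupp.linearCombination_id_surjective S M

variable (S) in
theorem exists_injective_embedding (M : Type u) [AddCommGroup M] [Module S M] :
    ∃ (J C : ModuleCat.{u} S) (f : M →ₗ[S] J) (g : J →ₗ[S] C), Module.Injective S J ∧
      IsSES f g := by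
  obtain ⟨J, hJ, f, hf⟩ := EnoughInjectives.presentation (ModuleCat.of S M)
  exact ⟨J, ModuleCat.of S (J ⧸ LinearMap.range f.hom), f.hom, (LinearMap.range f.hom).mkQ,
    Module.injective_module_of_injective_object S J,
    isSES_coker _ ((ModuleCat.mono_iff_injective f).1 hf)⟩

theorem injective_iff_hasInjectiveDimensionLT (M : Type u) [AddCommGroup M] [Module S M] :
    Module.Injective S M ↔ HasInjectiveDimensionLT (ModuleCat.of S M) 1 := by
  rw [← injective_iff_hasInjectiveDimensionLT_one]
  exact Module.injective_iff_injective_object S M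

/-- A module of finite injective dimension that is `Ext`-orthogonal to all injective modules is
injective: embedding an arbitrary module into an injective one shows that the top nonvanishing
`Ext` is already zero. -/
theorem injective_of_extZero_injective (M : Type u) [AddCommGroup M] [Module S M] (m : ℕ)
    (hM : HasInjectiveDimensionLT (ModuleCat.of S M) (m + 1))
    (h : ∀ E : ModuleCat.{u} S, Module.Injective S E → ∀ i, ExtZero S E M (i + 1)) :
    Module.Injective S M := by
  induction m with
  | zero => exact (injective_iff_hasInjectiveDimensionLT M).2 hM
  | succ m ih =>
    refine ih (hasInjectiveDimensionLT_of_enoughProjectives _ _ fun A => ?_)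
    obtain ⟨J, C, f, g, hJ, hfg⟩ := exists_injective_embedding S A
    exact hfg.extZero_left' (h J hJ m)
      (HasInjectiveDimensionLT.subsingleton (ModuleCat.of S M) (m + 2) (m + 2) le_rfl _)

end Ext

/-! ### Balancing of `Tor` -/

section Balance

variable {S T : Type u} [Ring S] [Ring T] [OppositeHom S T] [OppositeHom T S]

/-- Projective modules are flat, in terms of character modules: a map `X → P⁺` is transposed to
`P → X⁺` and lifted along `Y⁺ → X⁺`. -/
theorem injective_charDual_of_projective [OppositePair S T] [OppositePair T S]
    (P : Type u) [AddCommGroup P] [Module T P]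
    [Module.Projective T P] : Module.Injective S (CharDual T S P) := by
  refine ⟨fun X Y _ _ _ _ f hf φ => ?_⟩
  have hs : Function.Surjective (dualMap T f) := (isSES_coker f hf).dual.surjective
  obtain ⟨ψ, hψ⟩ := Module.projective_lifting_property (dualMap T f) (transpose φ) hs
  refine ⟨transpose ψ, fun x => CharDual.ext fun p => ?_⟩
  exact DFunLike.congr_fun (DFunLike.congr_fun hψ p) x

/-- `Tor` is balanced: both `Ext_S(B, A⁺)` and `Ext_T(A, B⁺)` are the dual of `Tor(A, B)`.  In degree
1, with `K → P → A` and `P` projective, extending `K → B⁺` to `P` is by transposition the same as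
lifting `B → K⁺` to `P⁺`. -/
theorem extZero_charDual_swap [OppositePair S T] [OppositePair T S] (i : ℕ)
    (A B : Type u) [AddCommGroup A] [AddCommGroup B] [Module T A]
    [Module S B] (h : ExtZero S B (CharDual T S A) (i + 1)) :
    ExtZero T A (CharDual S T B) (i + 1) := by
  induction i generalizing A with
  | zero =>
    obtain ⟨K, P, f, g, hP, hfg⟩ := exists_projective_cover T A
    refine hfg.extZero_one_of_extend (extZero_of_projective P _ 0) fun φ => ?_
    obtain ⟨ψ, hψ⟩ := (hfg.dual (T := S)).exists_lift h (transpose φ)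
    exact ⟨transpose ψ, fun a => CharDual.ext fun b => DFunLike.congr_fun (hψ b) a⟩
  | succ i ih =>
    obtain ⟨K, P, f, g, hP, hfg⟩ := exists_projective_cover T A
    have := injective_charDual_of_projective (S := S) (T := T) P
    exact hfg.extZero_right' (ih K ((hfg.dual (T := S)).extZero_right
      (extZero_of_injective _ _ i) h)) (extZero_of_projective P _ (i + 1))

end Balance

/-! ### Testing flat dimension on cyclic modules -/

section FlatDimension

variable {R : Type u} [Ring R]

theorem isFlatLeft_of_projective (P : Type u) [AddCommGroup P] [Module R P]
    [Module.Projective R P] : IsFlatLeft R P :=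
  (isFlatLeft_iff P).2 (injective_charDual_of_projective (S := Rᵐᵒᵖ) (T := R) P)

theorem isFlatRight_of_projective (P : Type u) [AddCommGroup P] [Module Rᵐᵒᵖ P]
    [Module.Projective Rᵐᵒᵖ P] : IsFlatRight R P :=
  (isFlatRight_iff P).2 (injective_charDual_of_projective (S := R) (T := Rᵐᵒᵖ) P)

/-- The flat dimension of `E` can be tested on the cyclic modules `R ⧸ I` with `I` finitely
generated. -/
theorem hasInjectiveDimensionLT_of_extZero_fg (n : ℕ) (E : Type u) [AddCommGroup E]
    [Module Rᵐᵒᵖ E]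
    (h : ∀ I : Submodule R R, I.FG → ExtZero R (R ⧸ I) (CharDual Rᵐᵒᵖ R E) (n + 1)) :
    HasInjectiveDimensionLT (ModuleCat.of R (CharDual Rᵐᵒᵖ R E)) (n + 1) := by
  induction n generalizing E with
  | zero =>
    refine (injective_iff_hasInjectiveDimensionLT _).1 (injective_charDual_of_fg E ?_)
    intro I hI φ
    exact (isSES_submodule I).exists_extend (h I hI) φ
  | succ n ih =>
    obtain ⟨K, P, f, g, hP, hfg⟩ := exists_projective_cover Rᵐᵒᵖ E
    have hinj := injective_charDual_of_projective (S := R) (T := Rᵐᵒᵖ) P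
    have hK := ih K fun I hI => (hfg.dual (T := R)).extZero_right
      (extZero_of_injective _ _ n) (h I hI)
    have : Injective (ModuleCat.of R (CharDual Rᵐᵒᵖ R P)) :=
      Module.injective_object_of_injective_module R _
    exact ((hfg.dual (T := R)).shortExact.hasInjectiveDimensionLT_X₃_iff n this).1 hK

end FlatDimension

/-! ### Resolutions and pushouts -/

section Resolution

variable {S : Type u} [Ring S] {A B C D : Type u} [AddCommGroup A] [AddCommGroup B]
  [AddCommGroup C] [AddCommGroup D] [Module S A] [Module S B] [Module S C] [Module S D]

theorem IsSES.exists_factor {f : A →ₗ[S] B} {g : B →ₗ[S] C} (h : IsSES f g) (φ : D →ₗ[S] B)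
    (hφ : ∀ d, g (φ d) = 0) : ∃ ψ : D →ₗ[S] A, ∀ d, f (ψ d) = φ d := by
  let e := LinearEquiv.ofInjective f h.injective
  refine ⟨e.symm.toLinearMap ∘ₗ φ.codRestrict _ fun d => (h.exact _).1 (hφ d), fun d => ?_⟩
  exact congrArg Subtype.val (e.apply_symm_apply ⟨φ d, (h.exact _).1 (hφ d)⟩)

theorem IsSES.exists_desc {f : A →ₗ[S] B} {g : B →ₗ[S] C} (h : IsSES f g) (φ : B →ₗ[S] D)
    (hφ : ∀ a, φ (f a) = 0) : ∃ ψ : C →ₗ[S] D, ∀ b, ψ (g b) = φ b := by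
  have hle : LinearMap.ker g ≤ LinearMap.ker φ := fun b hb => by
    obtain ⟨a, rfl⟩ := (h.exact b).1 hb
    exact hφ a
  refine ⟨(LinearMap.ker g).liftQ φ hle ∘ₗ
    (g.quotKerEquivOfSurjective h.surjective).symm.toLinearMap, fun b => ?_⟩
  have : (g.quotKerEquivOfSurjective h.surjective).symm (g b) = Submodule.Quotient.mk b := by
    rw [LinearEquiv.symm_apply_eq]
    rfl
  rw [LinearMap.comp_apply, LinearEquiv.coe_coe, this]
  rfl

theorem hasResolutionLE_zero_iff {P : ModuleCat.{u} S → Prop}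
    (hP : ∀ A B : ModuleCat.{u} S, (A ≃ₗ[S] B) → P A → P B) (M : ModuleCat.{u} S) :
    HasResolutionLE S P M 0 ↔ P M := by
  constructor
  · rintro ⟨G, d, ε, hG, h0, hs, hε, -⟩
    refine hP (G 0) M (LinearEquiv.ofBijective ε ⟨?_, hs⟩) (hG 0 le_rfl)
    refine (injective_iff_map_eq_zero ε).2 fun x hx => ?_
    obtain ⟨y, rfl⟩ := (hε x).1 hx
    have := h0 1 Nat.one_pos
    rw [Subsingleton.elim y 0, map_zero]
  · intro h
    refine ⟨fun i => match i with | 0 => M | _ + 1 => ModuleCat.of S PUnit, fun _ => 0,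
      LinearMap.id, ?_, ?_, Function.surjective_id, ?_, ?_⟩
    · intro i hi
      obtain rfl := Nat.le_zero.1 hi
      exact h
    · intro i hi
      obtain ⟨j, rfl⟩ := Nat.exists_eq_succ_of_ne_zero hi.ne'
      exact inferInstanceAs (Subsingleton PUnit)
    · intro x
      exact ⟨fun hx => ⟨0, hx.symm⟩, by rintro ⟨y, rfl⟩; rfl⟩
    · intro i x
      exact ⟨fun _ => ⟨0, Subsingleton.elim (α := PUnit) _ _⟩, fun _ => rfl⟩

/-- A resolution of length `n + 1` is a short exact sequence spliced with a resolution of length `n` of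
its kernel. -/
theorem hasResolutionLE_succ_iff (P : ModuleCat.{u} S → Prop) (M : Type u) [AddCommGroup M]
    [Module S M] (n : ℕ) :
    HasResolutionLE S P M (n + 1) ↔ ∃ (K Q : ModuleCat.{u} S) (f : K →ₗ[S] Q) (g : Q →ₗ[S] M),
      IsSES f g ∧ P Q ∧ HasResolutionLE S P K n := by
  constructor
  · rintro ⟨G, d, ε, hG, h0, hs, hε, hd⟩
    refine ⟨ModuleCat.of S (LinearMap.ker ε), G 0, (LinearMap.ker ε).subtype, ε, isSES_ker ε hs,
      hG 0 (Nat.zero_le _), fun i => G (i + 1), fun i => d (i + 1),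
      (d 0).codRestrict _ fun x => (hε _).2 ⟨x, rfl⟩, fun i hi => hG _ (Nat.succ_le_succ hi),
      fun i hi => h0 _ (Nat.succ_lt_succ hi), ?_, ?_, fun i => hd (i + 1)⟩
    · rintro ⟨x, hx⟩
      obtain ⟨y, rfl⟩ := (hε x).1 hx
      exact ⟨y, rfl⟩
    · intro x
      rw [← hd 0 x]
      exact Subtype.ext_iff
  · rintro ⟨K, Q, f, g, hfg, hQ, G, d, ε, hG, h0, hs, hε, hd⟩
    refine ⟨fun i => match i with | 0 => Q | i + 1 => G i,
      fun i => match i with | 0 => f ∘ₗ ε | i + 1 => d i, g, ?_, ?_, hfg.surjective, ?_, ?_⟩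
    · rintro (_ | i) hi
      · exact hQ
      · exact hG i (Nat.le_of_succ_le_succ hi)
    · rintro (_ | i) hi
      · exact absurd hi (Nat.not_lt_zero _)
      · exact h0 i (Nat.lt_of_succ_lt_succ hi)
    · intro x
      refine (hfg.exact x).trans ⟨?_, ?_⟩
      · rintro ⟨k, rfl⟩
        obtain ⟨y, rfl⟩ := hs k
        exact ⟨y, rfl⟩
      · rintro ⟨y, rfl⟩
        exact ⟨ε y, rfl⟩
    · rintro (_ | i)
      · intro x
        refine Iff.trans ?_ (hε x)
        exact ⟨fun h => hfg.injective (h.trans (map_zero f).symm),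
          fun h => (congrArg f h).trans (map_zero f)⟩
      · exact hd i

theorem HasResolutionLE.mono {P : ModuleCat.{u} S → Prop}
    (hP : ∀ A : ModuleCat.{u} S, Subsingleton A → P A) {M : Type u} [AddCommGroup M]
    [Module S M] {m n : ℕ} (hmn : m ≤ n) (h : HasResolutionLE S P M m) :
    HasResolutionLE S P M n := by
  obtain ⟨G, d, ε, hG, h0, h⟩ := h
  refine ⟨G, d, ε, fun i _ => ?_, fun i hi => h0 i (hmn.trans_lt hi), h⟩
  by_cases him : i ≤ m
  · exact hG i him
  · exact hP _ (h0 i (not_le.1 him))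

theorem iInf_natCast_le_iff (p : ℕ → Prop) (n : ℕ) :
    (⨅ (m : ℕ) (_ : p m), (m : ℕ∞)) ≤ n ↔ ∃ m ≤ n, p m := by
  constructor
  · intro h
    by_contra! hn
    have : ((n + 1 : ℕ) : ℕ∞) ≤ ⨅ (m : ℕ) (_ : p m), (m : ℕ∞) := by
      refine le_iInf₂ fun m hm => ?_
      by_contra hlt
      have hlt : m < n + 1 := by exact_mod_cast not_le.1 hlt
      exact hn m (Nat.lt_succ_iff.1 hlt) hm
    have := this.trans h
    norm_cast at this
    omega
  · rintro ⟨m, hm, hpm⟩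
    exact (iInf₂_le m hpm).trans (by exact_mod_cast hm)

/-- Two quotients by submodules: if `H → G → K` and `G → F → G'` are short exact, then so are
`H → F → F/H` and `K → F/H → G'`. -/
theorem IsSES.exists_quotient {H G K F G' : Type u} [AddCommGroup H] [AddCommGroup G]
    [AddCommGroup K] [AddCommGroup F] [AddCommGroup G'] [Module S H] [Module S G] [Module S K]
    [Module S F] [Module S G'] {h : H →ₗ[S] G} {q : G →ₗ[S] K} {i : G →ₗ[S] F} {p : F →ₗ[S] G'}
    (hq : IsSES h q) (ip : IsSES i p) :
    ∃ (L : ModuleCat.{u} S) (j : H →ₗ[S] F) (a : F →ₗ[S] L) (k : K →ₗ[S] L) (r : L →ₗ[S] G'),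
      IsSES j a ∧ IsSES k r := by
  have hinj : Function.Injective (i ∘ₗ h) := ip.injective.comp hq.injective
  have hja := isSES_coker (i ∘ₗ h) hinj
  obtain ⟨k, hk⟩ := hq.exists_desc ((LinearMap.range (i ∘ₗ h)).mkQ ∘ₗ i)
    fun x => (hja.exact _).2 ⟨x, rfl⟩
  obtain ⟨r, hr⟩ := hja.exists_desc p fun x => (ip.exact _).2 ⟨h x, rfl⟩
  refine ⟨ModuleCat.of S (F ⧸ LinearMap.range (i ∘ₗ h)), i ∘ₗ h, _, k, r, hja, ?_, ?_, ?_⟩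
  · refine (injective_iff_map_eq_zero k).2 fun x hx => ?_
    obtain ⟨y, rfl⟩ := hq.surjective x
    rw [hk] at hx
    obtain ⟨z, hz⟩ := (hja.exact _).1 hx
    rw [← ip.injective hz]
    exact (hq.exact _).2 ⟨z, rfl⟩
  · intro x
    obtain ⟨y, rfl⟩ := ip.surjective x
    exact ⟨_, hr y⟩
  · intro x
    obtain ⟨y, rfl⟩ := hja.surjective x
    rw [hr]
    constructor
    · intro hy
      obtain ⟨z, rfl⟩ := (ip.exact _).1 hy
      exact ⟨q z, hk z⟩
    · rintro ⟨z, hz⟩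
      obtain ⟨w, rfl⟩ := hq.surjective z
      rw [hk] at hz
      rw [← hr, ← hz]
      exact (hr _).trans ((ip.exact _).2 ⟨w, rfl⟩)

/-- The pushout of two injections `A → B` and `A → B'` with cokernels `C` and `C'`. -/
theorem IsSES.exists_pushout {A B C B' C' : Type u} [AddCommGroup A] [AddCommGroup B]
    [AddCommGroup C] [AddCommGroup B'] [AddCommGroup C'] [Module S A] [Module S B] [Module S C]
    [Module S B'] [Module S C'] {f : A →ₗ[S] B} {g : B →ₗ[S] C} {f' : A →ₗ[S] B'}
    {g' : B' →ₗ[S] C'} (h : IsSES f g) (h' : IsSES f' g') :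
    ∃ (P : ModuleCat.{u} S) (b : B →ₗ[S] P) (p' : P →ₗ[S] C') (b' : B' →ₗ[S] P)
      (p : P →ₗ[S] C), IsSES b p' ∧ IsSES b' p := by
  let k : A →ₗ[S] B × B' := f.prod (-f')
  have hk : IsSES k (LinearMap.range k).mkQ :=
    isSES_coker k fun x y hxy => h.injective (congrArg Prod.fst hxy)
  obtain ⟨p, hp⟩ := hk.exists_desc (g ∘ₗ LinearMap.fst S B B') fun a => (h.exact _).2 ⟨a, rfl⟩
  obtain ⟨p', hp'⟩ := hk.exists_desc (g' ∘ₗ LinearMap.snd S B B') fun a =>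
    (h'.exact _).2 ⟨-a, by simp [k]⟩
  refine ⟨ModuleCat.of S ((B × B') ⧸ LinearMap.range k),
    (LinearMap.range k).mkQ ∘ₗ LinearMap.inl S B B', p',
    (LinearMap.range k).mkQ ∘ₗ LinearMap.inr S B B', p, ⟨?_, ?_, ?_⟩, ⟨?_, ?_, ?_⟩⟩
  · refine (injective_iff_map_eq_zero _).2 fun x hx => ?_
    obtain ⟨a, ha⟩ := (hk.exact _).1 hx
    have h2 : a = 0 := h'.injective (by simpa [k] using congrArg Prod.snd ha)
    have h1 : f a = x := congrArg Prod.fst ha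
    rw [← h1, h2, map_zero]
  · intro c
    obtain ⟨y, rfl⟩ := h'.surjective c
    exact ⟨_, hp' (0, y)⟩
  · intro z
    obtain ⟨⟨x, y⟩, rfl⟩ := hk.surjective z
    constructor
    · intro hz
      rw [hp'] at hz
      obtain ⟨a, ha⟩ := (h'.exact _).1 hz
      refine ⟨x + f a, ?_⟩
      rw [LinearMap.comp_apply, ← sub_eq_zero, ← map_sub]
      exact (hk.exact _).2 ⟨a, Prod.ext (by simp [k]) (by simp [k, ha])⟩
    · rintro ⟨x', hx'⟩
      rw [← hx']
      exact (hp' (x', 0)).trans (map_zero g')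
  · refine (injective_iff_map_eq_zero _).2 fun y hy => ?_
    obtain ⟨a, ha⟩ := (hk.exact _).1 hy
    have h1 : a = 0 := h.injective (by simpa [k] using congrArg Prod.fst ha)
    have h2 : -f' a = y := congrArg Prod.snd ha
    rw [← h2, h1, map_zero, neg_zero]
  · intro c
    obtain ⟨x, rfl⟩ := h.surjective c
    exact ⟨_, hp (x, 0)⟩
  · intro z
    obtain ⟨⟨x, y⟩, rfl⟩ := hk.surjective z
    constructor
    · intro hz
      rw [hp] at hz
      obtain ⟨a, ha⟩ := (h.exact _).1 hz
      refine ⟨y + f' a, ?_⟩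
      rw [LinearMap.comp_apply, ← sub_eq_zero, ← map_sub]
      exact (hk.exact _).2 ⟨-a, Prod.ext (by simpa [k] using ha) (by simp [k])⟩
    · rintro ⟨y', hy'⟩
      rw [← hy']
      exact (hp (0, y')).trans (map_zero g)

end Resolution

/-! ### Flat dimension of right modules -/

section FlatDimension

variable {R : Type u} [Ring R]

theorem IsSES.hasInjectiveDimensionLT_charDual {S T : Type u} [Ring S] [Ring T]
    [OppositeHom S T] {A B C : Type u} [AddCommGroup A] [AddCommGroup B] [AddCommGroup C]
    [Module S A] [Module S B] [Module S C] {f : A →ₗ[S] B} {g : B →ₗ[S] C} (h : IsSES f g)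
    (hB : Module.Injective T (CharDual S T B)) (n : ℕ) :
    HasInjectiveDimensionLT (ModuleCat.of T (CharDual S T A)) (n + 1) ↔
      HasInjectiveDimensionLT (ModuleCat.of T (CharDual S T C)) (n + 2) :=
  (h.dual (T := T)).shortExact.hasInjectiveDimensionLT_X₃_iff n
    (Module.injective_object_of_injective_module T _)

theorem injective_charDual_of_subsingleton {S T : Type u} [Ring S] [Ring T] [OppositeHom S T] (A : Type u)
    [AddCommGroup A] [Module S A] [Subsingleton A] : Module.Injective T (CharDual S T A) :=
  ⟨fun _ _ _ _ _ _ _ _ _ => ⟨0, fun _ => CharDual.ext fun a => by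
    rw [Subsingleton.elim a 0, map_zero, map_zero]⟩⟩

theorem injective_charDual_of_equiv {S T : Type u} [Ring S] [Ring T] [OppositeHom S T]
    {A B : Type u} [AddCommGroup A] [AddCommGroup B] [Module S A] [Module S B] (e : A ≃ₗ[S] B)
    (h : Module.Injective T (CharDual S T A)) : Module.Injective T (CharDual S T B) := by
  refine ⟨fun X Y _ _ _ _ f hf φ => ?_⟩
  obtain ⟨ψ, hψ⟩ := h.out f hf (dualMap T e.toLinearMap ∘ₗ φ)
  refine ⟨dualMap T e.symm.toLinearMap ∘ₗ ψ, fun x => CharDual.ext fun b => ?_⟩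
  rw [LinearMap.comp_apply, hψ]
  simp

theorem hasResolutionLE_flat_iff (n : ℕ) (E : ModuleCat.{u} Rᵐᵒᵖ) :
    HasResolutionLE Rᵐᵒᵖ (fun G => IsFlatRight R G) E n ↔
      HasInjectiveDimensionLT (ModuleCat.of R (CharDual Rᵐᵒᵖ R E)) (n + 1) := by
  induction n generalizing E with
  | zero =>
    rw [hasResolutionLE_zero_iff, isFlatRight_iff, injective_iff_hasInjectiveDimensionLT]
    intro A B e h
    exact (isFlatRight_iff _).2 (injective_charDual_of_equiv e ((isFlatRight_iff _).1 h))
  | succ n ih =>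
    rw [hasResolutionLE_succ_iff]
    constructor
    · rintro ⟨K, Q, f, g, hfg, hQ, hK⟩
      exact (hfg.hasInjectiveDimensionLT_charDual ((isFlatRight_iff _).1 hQ) n).1 ((ih K).1 hK)
    · intro h
      obtain ⟨K, P, f, g, hP, hfg⟩ := exists_projective_cover Rᵐᵒᵖ E
      exact ⟨K, P, f, g, hfg, isFlatRight_of_projective P, (ih K).2
        ((hfg.hasInjectiveDimensionLT_charDual (injective_charDual_of_projective P) n).2 h)⟩

/-- The flat dimension of `E` is the injective dimension of its character module `E⁺`.  It is stated
through `HasInjectiveDimensionLT` since `injectiveDimension` takes the value `⊥` at zero modules. -/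
theorem fdRight_le_iff (n : ℕ) (E : ModuleCat.{u} Rᵐᵒᵖ) :
    fdRight R E ≤ n ↔ HasInjectiveDimensionLT (ModuleCat.of R (CharDual Rᵐᵒᵖ R E)) (n + 1) := by
  rw [← hasResolutionLE_flat_iff, fdRight, iInf_natCast_le_iff]
  constructor
  · rintro ⟨m, hm, h⟩
    exact h.mono (fun A _ => (isFlatRight_iff _).2 (injective_charDual_of_subsingleton A)) hm
  · exact fun h => ⟨n, le_rfl, h⟩

end FlatDimension

/-! ### Gorenstein flat modules -/

section GorensteinFlat

variable {R : Type u} [Ring R]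

/-- `Tor_i(E, M) = 0` for all injective right modules `E` and all `i ≥ 1`. -/
def TorOrthogonal (M : Type u) [AddCommGroup M] [Module R M] : Prop :=
  ∀ E : ModuleCat.{u} Rᵐᵒᵖ, Module.Injective Rᵐᵒᵖ E →
    ∀ i, ExtZero Rᵐᵒᵖ E (CharDual R Rᵐᵒᵖ M) (i + 1)

theorem IsGorensteinFlat.of_equiv {M N : Type u} [AddCommGroup M] [AddCommGroup N] [Module R M]
    [Module R N] (e : M ≃ₗ[R] N) (h : IsGorensteinFlat R M) : IsGorensteinFlat R N := by
  obtain ⟨F, d, h1, h2, ⟨e'⟩, h3⟩ := h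
  exact ⟨F, d, h1, h2, ⟨e.symm.trans e'⟩, h3⟩

theorem isSES_range {A B C : Type u} [AddCommGroup A] [AddCommGroup B] [AddCommGroup C]
    [Module R A] [Module R B] [Module R C] {f : A →ₗ[R] B} {g : B →ₗ[R] C}
    (h : Function.Exact f g) : IsSES (LinearMap.range f).subtype g.rangeRestrict := by
  refine ⟨Submodule.subtype_injective _, LinearMap.surjective_rangeRestrict g, fun x => ?_⟩
  refine (Subtype.ext_iff.trans (h x)).trans ?_
  exact ⟨fun hx => ⟨⟨x, hx⟩, rfl⟩, by rintro ⟨y, rfl⟩; exact y.2⟩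

theorem ExtZero.charDual_of_equiv {S T : Type u} [Ring S] [Ring T] [OppositeHom S T]
    {Y A B : Type u} [AddCommGroup Y] [AddCommGroup A] [AddCommGroup B] [Module T Y] [Module S A]
    [Module S B] {i : ℕ} (h : ExtZero T Y (CharDual S T B) i) (e : A ≃ₗ[S] B) :
    ExtZero T Y (CharDual S T A) i := by
  refine extZero_of_forall fun x => ?_
  have he : ModuleCat.ofHom (dualMap T e.symm.toLinearMap) ≫
      ModuleCat.ofHom (dualMap T e.toLinearMap) = 𝟙 (ModuleCat.of T (CharDual S T A)) := by
    ext χ : 2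
    refine CharDual.ext (S := S) (T := T) fun a => ?_
    change (χ : CharDual S T A) (e.symm (e a)) = χ a
    rw [e.symm_apply_apply]
  rw [← x.comp_mk₀_id, ← he, ← Abelian.Ext.mk₀_comp_mk₀,
    ← Abelian.Ext.comp_assoc_of_second_deg_zero, h.elim (x.comp _ _) 0, Abelian.Ext.zero_comp]

/-- Dimension shifting along the left half of a complete flat resolution. -/
theorem IsGorensteinFlat.torOrthogonal {M : Type u} [AddCommGroup M] [Module R M]
    (h : IsGorensteinFlat R M) : TorOrthogonal (R := R) M := by
  obtain ⟨F, d, hF, hd, ⟨e⟩, hE⟩ := h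
  have key : ∀ E : ModuleCat.{u} Rᵐᵒᵖ, Module.Injective Rᵐᵒᵖ E → ∀ (i : ℕ) (j : ℤ),
      ExtZero Rᵐᵒᵖ E (CharDual R Rᵐᵒᵖ (LinearMap.range (d j))) (i + 1) := by
    intro E hinj i
    induction i with
    | zero =>
      intro j
      -- the two differentials that precede `d j` enter, so `j` is written as `k + 1 + 1`
      obtain ⟨j, rfl⟩ : ∃ k, j = k + 1 := ⟨j - 1, by ring⟩
      obtain ⟨j, rfl⟩ : ∃ k, j = k + 1 := ⟨j - 1, by ring⟩
      have := (isFlatLeft_iff _).1 (hF (j + 1 + 1))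
      refine (isSES_range (hd (j + 1))).dual.extZero_one_of_lift
        (extZero_of_injective _ _ 0) fun φ => ?_
      obtain ⟨ψ, hψ⟩ := ((map_exact_iff _ _).1 (hE E hinj j)
        (dualMap Rᵐᵒᵖ (d (j + 1)).rangeRestrict ∘ₗ φ)).1 fun a b => by
          change φ a ((d (j + 1)).rangeRestrict (d j b)) = 0
          have : (d (j + 1)).rangeRestrict (d j b) = 0 :=
            Subtype.ext ((hd j _).2 ⟨b, rfl⟩)
          rw [this, map_zero]
      refine ⟨ψ, fun a => CharDual.ext ?_⟩
      rintro ⟨_, b, rfl⟩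
      exact hψ a b
    | succ i ih =>
      intro j
      obtain ⟨j, rfl⟩ : ∃ k, j = k + 1 := ⟨j - 1, by ring⟩
      have := (isFlatLeft_iff _).1 (hF (j + 1))
      exact (isSES_range (hd j)).dual.extZero_left (ih j) (extZero_of_injective _ _ (i + 1))
  exact fun E hinj i => (key E hinj i 0).charDual_of_equiv e

/-- The first step of the right half of a complete flat resolution. -/
theorem IsGorensteinFlat.exists_embedding {M : Type u} [AddCommGroup M] [Module R M]
    (h : IsGorensteinFlat R M) : ∃ (F N : ModuleCat.{u} R) (f : M →ₗ[R] F) (g : F →ₗ[R] N),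
      IsSES f g ∧ IsFlatLeft R F ∧ IsGorensteinFlat R N := by
  obtain ⟨F, d, hF, hd, ⟨e⟩, hE⟩ := h
  have hs := isSES_range (hd 0)
  refine ⟨F (0 + 1), ModuleCat.of R (LinearMap.range (d (0 + 1))),
    (LinearMap.range (d 0)).subtype ∘ₗ e.toLinearMap, (d (0 + 1)).rangeRestrict,
    ⟨hs.injective.comp e.injective, hs.surjective, fun x => (hs.exact x).trans ?_⟩, hF _,
    fun i => F (i + 1), fun i => d (i + 1), fun i => hF _, fun i => hd _,
    ⟨LinearEquiv.refl R _⟩, fun E hinj i => hE E hinj _⟩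
  constructor
  · rintro ⟨y, rfl⟩
    exact ⟨e.symm y, congrArg Subtype.val (e.apply_symm_apply y)⟩
  · rintro ⟨y, rfl⟩
    exact ⟨e y, rfl⟩

/-- A sequence that is spliced from short exact sequences `A i → F i → A (i + 1)`, which stay exact
after tensoring with injective modules. -/
theorem isGorensteinFlat_of_splice (A F : ℤ → ModuleCat.{u} R) (f : ∀ i, A i →ₗ[R] F i)
    (g : ∀ i, F i →ₗ[R] A (i + 1)) (hfg : ∀ i, IsSES (f i) (g i)) (hF : ∀ i, IsFlatLeft R (F i))
    (hA : ∀ i, TorOrthogonal (R := R) (A i)) : IsGorensteinFlat R (A (0 + 1)) := by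
  refine ⟨F, fun i => f (i + 1) ∘ₗ g i, hF, fun i x => ?_, ⟨?_⟩, fun E hE i => ?_⟩
  · have h0 : ∀ z, f (i + 1 + 1) z = 0 ↔ z = 0 := fun z =>
      map_eq_zero_iff _ (hfg (i + 1 + 1)).injective
    refine ((h0 _).trans ((hfg (i + 1)).exact x)).trans ?_
    constructor
    · rintro ⟨y, rfl⟩
      obtain ⟨z, rfl⟩ := (hfg i).surjective y
      exact ⟨z, rfl⟩
    · rintro ⟨z, rfl⟩
      exact ⟨g i z, rfl⟩
  · have hrange : LinearMap.range (f (0 + 1) ∘ₗ g 0) = LinearMap.range (f (0 + 1)) :=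
      LinearMap.range_comp_of_range_eq_top _ (LinearMap.range_eq_top.2 (hfg 0).surjective)
    exact (LinearEquiv.ofInjective _ (hfg (0 + 1)).injective).trans
      (LinearEquiv.ofEq _ _ hrange.symm)
  · refine (map_exact_iff _ _).2 fun φ => ⟨fun h => ?_, ?_⟩
    · -- `φ` factors through the dual of `A (i + 2)`, and then lifts to the dual of `F (i + 2)`
      obtain ⟨ψ, hψ⟩ := (hfg (i + 1)).dual.exists_factor φ fun a => CharDual.ext fun b => by
        obtain ⟨z, rfl⟩ := (hfg i).surjective b
        exact h a z
      obtain ⟨θ, hθ⟩ := (hfg (i + 1 + 1)).dual.exists_lift (hA _ E hE 0) ψ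
      refine ⟨θ, fun a b => ?_⟩
      rw [← hψ a, dualMap_apply, ← hθ a]
      rfl
    · rintro ⟨ψ, hψ⟩ a b
      rw [← hψ]
      have : g (i + 1) (f (i + 1) (g i b)) = 0 := ((hfg (i + 1)).exact _).2 ⟨_, rfl⟩
      change ψ a (f (i + 1 + 1) (g (i + 1) (f (i + 1) (g i b)))) = 0
      rw [this, map_zero, map_zero]

/-- A class `𝒞` of modules orthogonal to the injective right modules consists of Gorenstein flat
modules when each of its members is a quotient and a submodule of a flat module, with kernel,
respectively cokernel, in `𝒞`. -/
theorem isGorensteinFlat_of_class (𝒞 : ModuleCat.{u} R → Prop)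
    (horth : ∀ M, 𝒞 M → TorOrthogonal (R := R) M)
    (hleft : ∀ M, 𝒞 M → ∃ (N F : ModuleCat.{u} R) (f : N →ₗ[R] F) (g : F →ₗ[R] M),
      IsSES f g ∧ IsFlatLeft R F ∧ 𝒞 N)
    (hright : ∀ M, 𝒞 M → ∃ (F N : ModuleCat.{u} R) (f : M →ₗ[R] F) (g : F →ₗ[R] N),
      IsSES f g ∧ IsFlatLeft R F ∧ 𝒞 N)
    (M : ModuleCat.{u} R) (hM : 𝒞 M) : IsGorensteinFlat R M := by
  -- `Rel M N` means that `M → F → N` is short exact for some flat `F`; being a proposition, it can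
  -- be transported along equalities of indices before the sequences are chosen
  let Rel : {M // 𝒞 M} → {M // 𝒞 M} → Prop := fun M N =>
    ∃ (F : ModuleCat.{u} R) (f : M.1 →ₗ[R] F) (g : F →ₗ[R] N.1), IsSES f g ∧ IsFlatLeft R F
  have hl : ∀ M : {M // 𝒞 M}, ∃ N, Rel N M := fun M => by
    obtain ⟨N, F, f, g, h, hF, hN⟩ := hleft M.1 M.2
    exact ⟨⟨N, hN⟩, F, f, g, h, hF⟩
  have hr : ∀ M : {M // 𝒞 M}, ∃ N, Rel M N := fun M => by
    obtain ⟨F, N, f, g, h, hF, hN⟩ := hright M.1 M.2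
    exact ⟨⟨N, hN⟩, F, f, g, h, hF⟩
  choose l hl using hl
  choose r hr using hr
  let B : ℤ → {M // 𝒞 M} := fun i => match i with
    | Int.ofNat n => r^[n] ⟨M, hM⟩
    | Int.negSucc n => l^[n + 1] ⟨M, hM⟩
  have hB : ∀ i, Rel (B i) (B (i + 1)) := by
    rintro (n | n)
    · change Rel (r^[n] ⟨M, hM⟩) (r^[n + 1] ⟨M, hM⟩)
      rw [Function.iterate_succ_apply']
      exact hr _
    · cases n with
      | zero => exact hl _
      | succ n =>
        rw [show Int.negSucc (n + 1) + 1 = Int.negSucc n by omega]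
        change Rel (l^[n + 1 + 1] ⟨M, hM⟩) (l^[n + 1] ⟨M, hM⟩)
        rw [Function.iterate_succ_apply' l (n + 1)]
        exact hl _
  -- the spliced complex has `A 1` as its image in degree `0`, so `B` is shifted by one
  have hA : ∀ i, Rel (B (i - 1)) (B (i + 1 - 1)) := fun i => by
    have := hB (i - 1)
    rwa [show i - 1 + 1 = i + 1 - 1 by ring] at this
  choose F f g hfg hF using hA
  exact isGorensteinFlat_of_splice (fun i => (B (i - 1)).1) F f g hfg hF fun i => horth _ (B _).2

theorem IsFlatLeft.torOrthogonal {M : Type u} [AddCommGroup M] [Module R M]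
    (h : IsFlatLeft R M) : TorOrthogonal (R := R) M := fun _ _ i =>
  have := (isFlatLeft_iff M).1 h
  extZero_of_injective _ _ i

theorem IsFlatLeft.isGorensteinFlat {M : ModuleCat.{u} R} (h : IsFlatLeft R M) :
    IsGorensteinFlat R M := by
  have hP : IsFlatLeft R (ModuleCat.of R PUnit.{u + 1}) := isFlatLeft_of_projective PUnit
  refine isGorensteinFlat_of_class (fun M => IsFlatLeft R M) (fun M h => h.torOrthogonal)
    (fun M h => ⟨ModuleCat.of R PUnit, M, 0, LinearMap.id, ⟨?_, Function.surjective_id, ?_⟩, h, hP⟩)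
    (fun M h => ⟨M, ModuleCat.of R PUnit, LinearMap.id, 0, ⟨Function.injective_id, ?_, ?_⟩, h, hP⟩)
    M h
  · exact fun x y _ => Subsingleton.elim (α := PUnit) x y
  · exact fun x => ⟨fun hx => ⟨0, hx.symm⟩, by rintro ⟨y, rfl⟩; rfl⟩
  · exact fun x => ⟨0, Subsingleton.elim (α := PUnit) _ _⟩
  · exact fun x => ⟨fun _ => ⟨x, rfl⟩, fun _ => rfl⟩

theorem TorOrthogonal.of_isSES {K L G : Type u} [AddCommGroup K] [AddCommGroup L] [AddCommGroup G]
    [Module R K] [Module R L] [Module R G] {f : K →ₗ[R] L} {g : L →ₗ[R] G} (h : IsSES f g)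
    (hK : TorOrthogonal (R := R) K) (hG : TorOrthogonal (R := R) G) :
    TorOrthogonal (R := R) L :=
  fun E hE i => h.dual.extZero_mid (hG E hE i) (hK E hE i)

end GorensteinFlat

/-! ### Gorenstein flat dimension -/

section GorensteinFlatDimension

variable {R : Type u} [Ring R]

theorem hasResolutionLE_gorensteinFlat_zero_iff (M : ModuleCat.{u} R) :
    HasResolutionLE R (fun G => IsGorensteinFlat R G) M 0 ↔ IsGorensteinFlat R M :=
  hasResolutionLE_zero_iff (fun _ _ e h => h.of_equiv e) M

/-- Over a left GF-closed ring, a module of finite Gorenstein flat dimension embeds into a module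
of finite flat dimension with Gorenstein flat cokernel. -/
theorem exists_embedding_of_hasResolutionLE (hR : IsLeftGFClosed R) (n : ℕ)
    (K : ModuleCat.{u} R) (hK : HasResolutionLE R (fun G => IsGorensteinFlat R G) K n) :
    ∃ (L G : ModuleCat.{u} R) (k : K →ₗ[R] L) (r : L →ₗ[R] G), IsSES k r ∧
      (∃ m, HasInjectiveDimensionLT (ModuleCat.of Rᵐᵒᵖ (CharDual R Rᵐᵒᵖ L)) (m + 1)) ∧
      IsGorensteinFlat R G := by
  induction n generalizing K with
  | zero =>
    obtain ⟨F, N, f, g, hfg, hF, hN⟩ :=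
      ((hasResolutionLE_gorensteinFlat_zero_iff K).1 hK).exists_embedding
    exact ⟨F, N, f, g, hfg, ⟨0, (injective_iff_hasInjectiveDimensionLT _).1
      ((isFlatLeft_iff _).1 hF)⟩, hN⟩
  | succ n ih =>
    obtain ⟨K₁, G₀, f, g, hfg, hG₀, hK₁⟩ := (hasResolutionLE_succ_iff _ _ _).1 hK
    obtain ⟨L, G, k, r, hkr, ⟨m, hm⟩, hG⟩ := ih K₁ hK₁
    -- `P` is an extension of `G` by `G₀`, hence Gorenstein flat, and maps onto `K` with kernel `L`
    obtain ⟨P, b, p', b', p, hb, hb'⟩ := hfg.exists_pushout hkr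
    have hP : IsGorensteinFlat R P := hR G₀ P G b p' hb.injective hb.surjective hb.exact hG₀ hG
    obtain ⟨F, N, i, q, hiq, hF, hN⟩ := hP.exists_embedding
    obtain ⟨L', j, a, k', r', hja, hkr'⟩ := hb'.exists_quotient hiq
    exact ⟨L', N, k', r', hkr', ⟨m + 1, (hja.hasInjectiveDimensionLT_charDual
      ((isFlatLeft_iff _).1 hF) m).1 hm⟩, hN⟩

/-- Over a left GF-closed ring all of whose modules have finite Gorenstein flat dimension, the modules
orthogonal to the injective right modules are Gorenstein flat.  Such a module `M` embeds into some `L` of finite flat dimension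
with Gorenstein flat cokernel; `L` is again orthogonal to the injectives, which forces it to be
flat. -/
theorem isGorensteinFlat_of_torOrthogonal (hR : IsLeftGFClosed R)
    (hfin : ∀ M : ModuleCat.{u} R, ∃ n, HasResolutionLE R (fun G => IsGorensteinFlat R G) M n)
    (M : ModuleCat.{u} R) (hM : TorOrthogonal (R := R) M) : IsGorensteinFlat R M := by
  refine isGorensteinFlat_of_class (fun M => TorOrthogonal (R := R) M) (fun _ h => h)
    (fun M hM => ?_) (fun M hM => ?_) M hM
  · obtain ⟨K, P, f, g, hP, hfg⟩ := exists_projective_cover R M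
    have hflat := isFlatLeft_of_projective (R := R) P
    exact ⟨K, P, f, g, hfg, hflat, fun E hE i =>
      hfg.dual.extZero_right (hflat.torOrthogonal E hE i) (hM E hE (i + 1))⟩
  · obtain ⟨n, hn⟩ := hfin M
    obtain ⟨L, G, k, r, hkr, ⟨m, hm⟩, hG⟩ := exists_embedding_of_hasResolutionLE hR n M hn
    have hL : TorOrthogonal (R := R) L := .of_isSES hkr hM hG.torOrthogonal
    exact ⟨L, G, k, r, hkr, (isFlatLeft_iff _).2 (injective_of_extZero_injective _ m hm hL),
      hG.torOrthogonal⟩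

/-- If `M` has Gorenstein flat dimension at most `n`, then `Tor_j(E, M) = 0` for all injective `E` and
all `j > n`. -/
theorem extZero_of_hasResolutionLE (n : ℕ) (M : ModuleCat.{u} R)
    (hM : HasResolutionLE R (fun G => IsGorensteinFlat R G) M n) (E : ModuleCat.{u} Rᵐᵒᵖ)
    (hE : Module.Injective Rᵐᵒᵖ E) (i : ℕ) :
    ExtZero Rᵐᵒᵖ E (CharDual R Rᵐᵒᵖ M) (n + i + 1) := by
  induction n generalizing M with
  | zero =>
    rw [zero_add]
    exact ((hasResolutionLE_gorensteinFlat_zero_iff M).1 hM).torOrthogonal E hE i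
  | succ n ih =>
    obtain ⟨K, G, f, g, hfg, hG, hK⟩ := (hasResolutionLE_succ_iff _ _ _).1 hM
    rw [add_right_comm n 1 i]
    exact hfg.dual.extZero_left (ih K hK) (hG.torOrthogonal E hE (n + i + 1))

/-- Over a left GF-closed ring all of whose modules have finite Gorenstein flat dimension, if
`Tor_j(E, M) = 0` for all injective `E` and all `j > n`, then the `n`-th syzygy of `M` is Gorenstein flat. -/
theorem hasResolutionLE_of_extZero (hR : IsLeftGFClosed R)
    (hfin : ∀ M : ModuleCat.{u} R, ∃ n, HasResolutionLE R (fun G => IsGorensteinFlat R G) M n)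
    (n : ℕ) (M : ModuleCat.{u} R)
    (hM : ∀ E : ModuleCat.{u} Rᵐᵒᵖ, Module.Injective Rᵐᵒᵖ E → ∀ i : ℕ,
      ExtZero Rᵐᵒᵖ E (CharDual R Rᵐᵒᵖ M) (n + i + 1)) :
    HasResolutionLE R (fun G => IsGorensteinFlat R G) M n := by
  induction n generalizing M with
  | zero =>
    refine (hasResolutionLE_gorensteinFlat_zero_iff M).2
      (isGorensteinFlat_of_torOrthogonal hR hfin M fun E hE i => ?_)
    have := hM E hE i
    rwa [zero_add] at this
  | succ n ih =>
    obtain ⟨K, P, f, g, hP, hfg⟩ := exists_projective_cover R M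
    have hflat := isFlatLeft_of_projective (R := R) P
    refine (hasResolutionLE_succ_iff _ _ _).2 ⟨K, P, f, g, hfg, hflat.isGorensteinFlat,
      ih K fun E hE i => ?_⟩
    have := hM E hE i
    rw [add_right_comm n 1 i] at this
    exact hfg.dual.extZero_right (hflat.torOrthogonal E hE (n + i)) this

theorem gfd_le_iff (n : ℕ) (M : Type u) [AddCommGroup M] [Module R M] :
    gfd R M ≤ n ↔ HasResolutionLE R (fun G => IsGorensteinFlat R G) M n := by
  rw [gfd, iInf_natCast_le_iff]
  constructor
  · rintro ⟨m, hm, h⟩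
    refine h.mono (fun A _ => IsFlatLeft.isGorensteinFlat ?_) hm
    exact (isFlatLeft_iff _).2 (injective_charDual_of_subsingleton A)
  · exact fun h => ⟨n, le_rfl, h⟩

/-- A right module of finite injective dimension has flat dimension at most the supremum of those
of the injective right modules. -/
theorem hasInjectiveDimensionLT_charDual_of_injective (n : ℕ)
    (h : ∀ E : ModuleCat.{u} Rᵐᵒᵖ, Module.Injective Rᵐᵒᵖ E →
      HasInjectiveDimensionLT (ModuleCat.of R (CharDual Rᵐᵒᵖ R E)) (n + 1))
    (d : ℕ) (E : ModuleCat.{u} Rᵐᵒᵖ) (hE : HasInjectiveDimensionLT E (d + 1)) :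
    HasInjectiveDimensionLT (ModuleCat.of R (CharDual Rᵐᵒᵖ R E)) (n + 1) := by
  induction d generalizing E with
  | zero => exact h E ((injective_iff_hasInjectiveDimensionLT E).2 hE)
  | succ d ih =>
    obtain ⟨J, C, f, g, hJ, hfg⟩ := exists_injective_embedding Rᵐᵒᵖ E
    have hC := ih C ((hfg.shortExact.hasInjectiveDimensionLT_X₃_iff d
      (Module.injective_object_of_injective_module Rᵐᵒᵖ J)).2 hE)
    exact (hfg.dual (T := R)).shortExact.hasInjectiveDimensionLT_X₃ (n + 1) (h J hJ)
      (hasInjectiveDimensionLT_of_ge _ (n + 1) _ (Nat.le_succ _))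

theorem eq_of_forall_le_natCast_iff {a b : ℕ∞} (h : ∀ n : ℕ, a ≤ n ↔ b ≤ n) : a = b :=
  eq_of_forall_ge_iff fun c => by
    cases c with
    | top => simp
    | coe n => exact h n

end GorensteinFlatDimension

end WeakGorenstein

open WeakGorenstein

theorem lemma2p3 (R : Type u) [Ring R] (hR : WeakGorenstein.IsLeftGFClosed R)
    (hfin : WeakGorenstein.lGwdim R < ⊤) :
    (∀ n : ℕ, List.TFAE [
      WeakGorenstein.lGwdim R ≤ n,
      ∀ M : ModuleCat.{u} R, Module.FinitePresentation R M → WeakGorenstein.gfd R M ≤ n,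
      ∀ I : Submodule R R, I.FG → WeakGorenstein.gfd R (R ⧸ I) ≤ n,
      ∀ E : ModuleCat.{u} Rᵐᵒᵖ, Module.Injective Rᵐᵒᵖ E → WeakGorenstein.fdRight R E ≤ n,
      ∀ E : ModuleCat.{u} Rᵐᵒᵖ, injectiveDimension E < ⊤ → WeakGorenstein.fdRight R E ≤ n]) ∧
    WeakGorenstein.lGwdim R =
      (⨆ (I : Submodule R R) (_ : I.FG), WeakGorenstein.gfd R (R ⧸ I)) ∧
    WeakGorenstein.lGwdim R =
      (⨆ (M : ModuleCat.{u} R) (_ : Module.FinitePresentation R M), WeakGorenstein.gfd R M) ∧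
    WeakGorenstein.lGwdim R =
      (⨆ (E : ModuleCat.{u} Rᵐᵒᵖ) (_ : Module.Injective Rᵐᵒᵖ E), WeakGorenstein.fdRight R E) ∧
    WeakGorenstein.lGwdim R =
      (⨆ (E : ModuleCat.{u} Rᵐᵒᵖ) (_ : injectiveDimension E < ⊤),
        WeakGorenstein.fdRight R E) := by
  have hres : ∀ M : ModuleCat.{u} R,
      ∃ n, HasResolutionLE R (fun G => IsGorensteinFlat R G) M n := fun M => by
    have hM : gfd R M < ⊤ := (le_iSup (fun M : ModuleCat.{u} R => gfd R M) M).trans_lt hfin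
    obtain ⟨n, hn⟩ := ENat.ne_top_iff_exists.1 hM.ne
    exact ⟨n, (gfd_le_iff n M).1 hn.ge⟩
  have main : ∀ n : ℕ, List.TFAE [
      lGwdim R ≤ n,
      ∀ M : ModuleCat.{u} R, Module.FinitePresentation R M → gfd R M ≤ n,
      ∀ I : Submodule R R, I.FG → gfd R (R ⧸ I) ≤ n,
      ∀ E : ModuleCat.{u} Rᵐᵒᵖ, Module.Injective Rᵐᵒᵖ E → fdRight R E ≤ n,
      ∀ E : ModuleCat.{u} Rᵐᵒᵖ, injectiveDimension E < ⊤ → fdRight R E ≤ n] := by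
    intro n
    tfae_have 1 → 2 := fun h M _ => (le_iSup (fun M : ModuleCat.{u} R => gfd R M) M).trans h
    tfae_have 2 → 3 := fun h I hI =>
      h (ModuleCat.of R (R ⧸ I)) (Module.finitePresentation_of_surjective I.mkQ
        I.mkQ_surjective (by rwa [Submodule.ker_mkQ]))
    tfae_have 3 → 4 := fun h E hE => by
      rw [fdRight_le_iff]
      refine hasInjectiveDimensionLT_of_extZero_fg n E fun I hI => ?_
      exact extZero_charDual_swap n (R ⧸ I) E (extZero_of_hasResolutionLE n
        (ModuleCat.of R (R ⧸ I)) ((gfd_le_iff n _).1 (h I hI)) E hE 0)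
    tfae_have 4 → 5 := fun h E hE => by
      obtain ⟨d, hd⟩ := (injectiveDimension_ne_top_iff E).1 hE.ne
      rw [fdRight_le_iff]
      exact hasInjectiveDimensionLT_charDual_of_injective n
        (fun J hJ => (fdRight_le_iff n J).1 (h J hJ)) d E hd
    tfae_have 5 → 4 := fun h E hE => by
      refine h E (lt_top_iff_ne_top.2 ((injectiveDimension_ne_top_iff E).2 ⟨0, ?_⟩))
      exact (injective_iff_hasInjectiveDimensionLT E).1 hE
    tfae_have 4 → 1 := fun h => by
      refine iSup_le fun M => (gfd_le_iff n M).2 (hasResolutionLE_of_extZero hR hres n M ?_)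
      intro E hE i
      have := (fdRight_le_iff n E).1 (h E hE)
      exact extZero_charDual_swap (n + i) E M (HasInjectiveDimensionLT.subsingleton
        (ModuleCat.of R (CharDual Rᵐᵒᵖ R E)) (n + 1) (n + i + 1) (by omega) _)
    tfae_finish
  refine ⟨main, ?_, ?_, ?_, ?_⟩ <;> refine eq_of_forall_le_natCast_iff fun n => ?_
  · exact ((main n).out 0 2).trans iSup₂_le_iff.symm
  · exact ((main n).out 0 1).trans iSup₂_le_iff.symm
  · exact ((main n).out 0 3).trans iSup₂_le_iff.symm
  · exact ((main n).out 0 4).trans iSup₂_le_iff.symm
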